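/- All rings and algebras are associative with identity, and subrings and subalgebras contain the identity of the whole ring. Let $F$ be a field and let $C$ be an $F$-algebra. We say that $C$ is a *simple PI-algebra over $F$* if $C$ is a simple ring and some nonzero polynomial in noncommuting indeterminates with coefficients in $F$ vanishes under all substitutions of elements of $C$. We say that $C$ is a *finite-dimensional central simple algebra over $F$* if $C$ is a simple ring, its center $Z(C)$ equals $F$, and $\dim_F C<\infty$. Let $K$ be a field and let $A$ be a $K$-algebra. We say that $A$ is an *almost locally simple PI-algebra* (respectively, an *almost locally finite-dimensional central simple algebra*) if every finitely generated $K$-subalgebra of $A$ is contained in a subring $C$ of $A$ that is a simple PI-algebra (respectively, a finite-dimensional central simple algebra) over some field $F$; here $F$ may depend on the subalgebra and need not be $K$. **Theorem.** Let $A$ be an algebra over a field $K$. 1. $A$ is an almost locally simple PI-algebra if and only if $A$ is an almost locally finite-dimensional central simple algebra. 2. $A$ is a simple PI-algebra over $K$ if and only if $A$ is a finite-dimensional central simple algebra over some field (necessarily isomorphic to its center). -/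

import Mathlib

universe u v

/-- The `F`-algebra `A` satisfies a polynomial identity: some nonzero polynomial in noncommuting
indeterminates `X₀, X₁, …` with coefficients in `F` vanishes under every substitution of elements
of `A` for the indeterminates. -/
def IsPIAlgebra (F : Type u) (A : Type v) [Field F] [Ring A] [Algebra F A] : Prop :=
  ∃ f : FreeAlgebra F ℕ, f ≠ 0 ∧ ∀ x : ℕ → A, FreeAlgebra.lift F x f = 0

/-- `A` is a simple PI-algebra over the field `F`. -/
def IsSimplePIAlgebra (F : Type u) (A : Type v) [Field F] [Ring A] [Algebra F A] : Prop :=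
  IsSimpleRing A ∧ IsPIAlgebra F A

/-- `A` is a finite-dimensional central simple algebra over the field `F`: a simple ring whose
center is `F` and which has finite dimension over `F`. -/
def IsFDCentralSimple (F : Type u) (A : Type v) [Field F] [Ring A] [Algebra F A] : Prop :=
  IsSimpleRing A ∧ Algebra.IsCentral F A ∧ FiniteDimensional F A

/-- Every finitely generated `K`-subalgebra of `A` is contained in a subring `C` of `A` which is a
simple PI-algebra over some field `F`. The field may vary with the subalgebra and need not be
related to `K`. As `F` embeds in the nonzero ring `C`, it is no restriction to take `F` in the
universe of `A`. -/
def IsAlmostLocallySimplePI (K : Type u) (A : Type v) [Field K] [Ring A] [Algebra K A] : Prop :=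
  ∀ B : Subalgebra K A, B.FG → ∃ C : Subring A, B.toSubring ≤ C ∧
    ∃ (F : Type v) (_ : Field F) (_ : Algebra F C), IsSimplePIAlgebra F C

/-- Every finitely generated `K`-subalgebra of `A` is contained in a subring `C` of `A` which is a
finite-dimensional central simple algebra over some field `F`. The field may vary with the
subalgebra and need not be related to `K`. As `F` is isomorphic to the center of `C`, it is no
restriction to take `F` in the universe of `A`. -/
def IsAlmostLocallyFDCentralSimple (K : Type u) (A : Type v) [Field K] [Ring A] [Algebra K A] :
    Prop :=
  ∀ B : Subalgebra K A, B.FG → ∃ C : Subring A, B.toSubring ≤ C ∧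
    ∃ (F : Type v) (_ : Field F) (_ : Algebra F C), IsFDCentralSimple F C

/-!
The content of the theorem is that a simple PI-algebra `A` has finite dimension over its center `Z`
(Kaplansky), and that a finite-dimensional algebra over any field `F` satisfies an identity over
every field `K` over which it is an algebra. The latter holds for the standard polynomial of degree
greater than `dim_F A`, which is alternating and has coefficients `±1`. Both parts of the theorem
follow, the local one by applying this to each subring `C`.

For Kaplansky's theorem, polarization along a longest monomial of the given identity yields a
multilinear identity `∑ σ, β σ * y (σ 0) * ⋯ * y (σ (d - 1)) = 0` with `β 1 = 1`
(`IsPIAlgebra.exists_multilinear`). Let `M` be a simple left `A`-module and `L` a maximal subfield of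
the division ring `D = End A M`. The subalgebra `R` of `End L M` generated by `A` is spanned over
`L` by the image of `A`, so it satisfies the same multilinear identity. Moreover `M` is a simple
`R`-module and `End R M` is the centralizer of `L` in `D`, which is `L`. By the Jacobson density
theorem, `d + 1` vectors of `M` that are linearly independent over `L` would admit operators in `R`
that shift them, and the identity evaluated at these operators would be nonzero. Hence `M` has
dimension at most `d` over `L` (`finiteDimensional_of_multilinear_identity`).

Finally, `A` is central simple over `Z`, so the map from `L ⊗[Z] A` to `End L M` is injective
(`injective_tensor_end`), and `dim_Z A = dim_L (L ⊗[Z] A)` is finite. Working with `L` on the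
module `M` directly makes the Wedderburn structure theorem and a separate treatment of division
rings unnecessary.
-/

/-! ### Multilinearization of polynomial identities -/

open Finset in
/-- Inclusion–exclusion over the sets `S` containing a fixed set `R`. -/
theorem sum_neg_one_pow_card_of_subset {ι : Type*} [Fintype ι] [DecidableEq ι] (R : Finset ι) :
    (∑ S : Finset ι, if R ⊆ S then (-1 : ℤ) ^ #S else 0) =
      if R = univ then (-1) ^ Fintype.card ι else 0 := by
  split_ifs with h
  · subst h
    simp [univ_subset_iff]
  · obtain ⟨i, hi⟩ : ∃ i, i ∉ R := by simpa [Finset.eq_univ_iff_forall] using h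
    -- Pair each `S` not containing `i` with `insert i S`; the two signs cancel.
    rw [← Finset.powerset_univ, ← Finset.insert_erase (mem_univ i),
      Finset.sum_powerset_insert (notMem_erase i _), ← Finset.sum_add_distrib]
    refine Finset.sum_eq_zero fun S hS => ?_
    have hiS : i ∉ S := fun h => notMem_erase i _ (mem_powerset.1 hS h)
    simp only [Finset.subset_insert_iff_of_notMem hi, card_insert_of_notMem hiS, pow_succ]
    split_ifs <;> simp

open Finset in
/-- Polarization: expand `T` at sums over `S` and take the alternating sum over all `S`. Only the
terms whose choice function `κ → ι` is surjective survive. -/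
theorem MultilinearMap.sum_neg_one_pow_card_smul_map_sum {R M N ι κ : Type*} [CommRing R]
    [AddCommGroup M] [Module R M] [AddCommGroup N] [Module R N] [Fintype ι] [DecidableEq ι]
    [Fintype κ] [DecidableEq κ] (T : MultilinearMap R (fun _ : κ => M) N) (g : κ → ι → M) :
    ∑ S : Finset ι, (-1 : ℤ) ^ #S • T (fun t => ∑ i ∈ S, g t i) =
      (-1 : ℤ) ^ Fintype.card ι •
        ∑ c : κ → ι, if Function.Surjective c then T (fun t => g t (c t)) else 0 := by
  have h1 : ∀ S : Finset ι, (-1 : ℤ) ^ #S • T (fun t => ∑ i ∈ S, g t i) =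
      ∑ c : κ → ι, (if univ.image c ⊆ S then (-1 : ℤ) ^ #S else 0) • T (fun t => g t (c t)) := by
    intro S
    rw [T.map_sum_finset, Finset.smul_sum, ← Finset.sum_filter_add_sum_filter_not univ
      (fun c : κ → ι => univ.image c ⊆ S)]
    rw [Finset.sum_eq_zero (s := univ.filter fun c : κ → ι => ¬ univ.image c ⊆ S), add_zero]
    · refine Finset.sum_congr ?_ fun c hc => ?_
      · ext c; simp [Finset.subset_iff]
      · rw [if_pos (Finset.mem_filter.1 hc).2]
    · intro c hc
      rw [if_neg (Finset.mem_filter.1 hc).2, zero_smul]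
  simp_rw [h1]
  rw [Finset.sum_comm, Finset.smul_sum]
  refine Finset.sum_congr rfl fun c _ => ?_
  rw [← Finset.sum_smul, sum_neg_one_pow_card_of_subset]
  simp only [Finset.eq_univ_iff_forall, Finset.mem_image, mem_univ, true_and]
  by_cases h : Function.Surjective c
  · rw [if_pos h, if_pos (fun i => h i)]
  · rw [if_neg h, if_neg (fun h' => h fun i => h' i), zero_smul, smul_zero]

open Finset in
/-- Polarization of a single monomial. Substitute for each letter `j` of the word `v` the sum of
those `y i`, `i ∈ S`, with `w i = j`, and take the alternating sum over `S`. For `v` of length at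
most `d` only the terms in which every `y i` occurs survive; each of these uses every `y i` exactly
once, and `v` must then be a rearrangement of `w`. -/
theorem sum_neg_one_pow_card_smul_prod_map {A : Type*} [Ring A] {X : Type*} [DecidableEq X]
    {d : ℕ} (w : Fin d → X) (y : Fin d → A) (v : List X) (hv : v.length ≤ d) :
    ∑ S : Finset (Fin d), (-1 : ℤ) ^ #S • (v.map fun j => ∑ i ∈ S, if w i = j then y i else 0).prod =
      (-1 : ℤ) ^ d • ∑ σ : Equiv.Perm (Fin d),
        if List.ofFn (w ∘ σ) = v then (List.ofFn (y ∘ σ)).prod else 0 := by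
  obtain ⟨k, u, rfl⟩ : ∃ k, ∃ u : Fin k → X, v = List.ofFn u := ⟨_, v.get, (List.ofFn_get v).symm⟩
  rw [List.length_ofFn] at hv
  have key := MultilinearMap.sum_neg_one_pow_card_smul_map_sum
    (MultilinearMap.mkPiAlgebraFin ℤ k A) (fun t i => if w i = u t then y i else 0)
  simp only [MultilinearMap.mkPiAlgebraFin_apply, Fintype.card_fin] at key
  simp only [List.map_ofFn, Function.comp_def] at key ⊢
  rw [key]
  congr 1
  -- A surjection `Fin k → Fin d` with `k ≤ d` exists only for `k = d`, where it is a permutation.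
  rcases hv.lt_or_eq with hlt | rfl
  · rw [Finset.sum_eq_zero, Finset.sum_eq_zero]
    · intro σ _
      rw [if_neg]
      intro h
      have := congrArg List.length h
      simp at this
      omega
    · intro c _
      rw [if_neg]
      intro h
      have := Fintype.card_le_of_surjective c h
      simp at this
      omega
  · rw [← Finset.sum_filter]
    symm
    refine Finset.sum_bij (fun σ _ => ⇑σ) (fun σ _ => by simpa using σ.surjective)
      (fun σ _ τ _ h => DFunLike.coe_injective h) (fun c hc => ?_) (fun σ _ => ?_)
    · have hc : Function.Surjective c := by simpa using hc
      exact ⟨Equiv.ofBijective c (Finite.injective_iff_bijective.1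
        (Finite.injective_iff_surjective.2 hc)), mem_univ _, rfl⟩
    · split_ifs with h
      · have h' := List.ofFn_injective h
        simp [funext_iff] at h'
        simp [h']
      · obtain ⟨t, ht⟩ : ∃ t, ¬ w (σ t) = u t := by
          by_contra! hcon
          exact h (by simp [hcon])
        symm
        apply List.prod_eq_zero
        rw [List.mem_ofFn]
        exact ⟨t, by simp [ht]⟩

theorem FreeAlgebra.lift_eq_sum {K X A : Type*} [Field K] [Ring A] [Algebra K A]
    (f : FreeAlgebra K X) (x : X → A) :
    FreeAlgebra.lift K x f =
      (FreeAlgebra.equivMonoidAlgebraFreeMonoid f).coeff.sum fun v c => c • (v.toList.map x).prod := by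
  have h : FreeAlgebra.lift K x = (MonoidAlgebra.lift K A (FreeMonoid X) (FreeMonoid.lift x)).comp
      (FreeAlgebra.equivMonoidAlgebraFreeMonoid (R := K) (X := X)).toAlgHom := by
    ext j
    simp [FreeAlgebra.equivMonoidAlgebraFreeMonoid]
  rw [h]
  simp [MonoidAlgebra.lift_apply, FreeMonoid.lift_apply]

/-- A PI-algebra satisfies a multilinear identity `∑ σ, β σ * y (σ 0) * ⋯ * y (σ (d - 1)) = 0` with
`β 1 = 1`. The coefficients are taken in `A` itself, which makes the base field irrelevant from
then on. -/
theorem IsPIAlgebra.exists_multilinear {K : Type*} {A : Type*} [Field K] [Ring A] [Algebra K A]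
    (h : IsPIAlgebra K A) :
    ∃ (d : ℕ) (β : Equiv.Perm (Fin d) → A), β 1 = 1 ∧
      ∀ y : Fin d → A, ∑ σ, β σ * (List.ofFn (y ∘ σ)).prod = 0 := by
  classical
  obtain ⟨f, hf0, hf⟩ := h
  set p := (FreeAlgebra.equivMonoidAlgebraFreeMonoid f).coeff with hp
  have hp0 : p ≠ 0 := by simpa [hp] using hf0
  obtain ⟨v, hv, hmax⟩ := Finset.exists_max_image p.support (fun v => v.toList.length)
    (Finsupp.support_nonempty_iff.2 hp0)
  -- Polarize `f` along a word `v` of maximal length in its support; dividing by the coefficient of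
  -- `v` normalizes the resulting identity.
  set d := v.toList.length
  let w : Fin d → ℕ := v.toList.get
  have hpv : p v ≠ 0 := Finsupp.mem_support_iff.1 hv
  refine ⟨d, fun σ => algebraMap K A ((p v)⁻¹ * p (FreeMonoid.ofList (List.ofFn (w ∘ σ)))), ?_, ?_⟩
  · have : FreeMonoid.ofList (List.ofFn (w ∘ (1 : Equiv.Perm (Fin d)))) = v := by
      simp [w]
    simp only [this, inv_mul_cancel₀ hpv, map_one]
  · intro y
    have h1 : ∑ S : Finset (Fin d), (-1 : ℤ) ^ S.card •
        (p.sum fun v c => c • (v.toList.map fun j => ∑ i ∈ S, if w i = j then y i else 0).prod)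
          = 0 := by
      refine Finset.sum_eq_zero fun S _ => ?_
      rw [hp, ← FreeAlgebra.lift_eq_sum, hf, smul_zero]
    simp only [Finsupp.sum, Finset.smul_sum] at h1
    rw [Finset.sum_comm] at h1
    have h2 : ∀ v ∈ p.support, ∑ S : Finset (Fin d), (-1 : ℤ) ^ S.card •
        p v • (v.toList.map fun j => ∑ i ∈ S, if w i = j then y i else 0).prod =
        (-1 : ℤ) ^ d • ∑ σ : Equiv.Perm (Fin d), p v •
          if FreeMonoid.ofList (List.ofFn (w ∘ σ)) = v then (List.ofFn (y ∘ σ)).prod else 0 := by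
      intro v hv
      have := sum_neg_one_pow_card_smul_prod_map w y v.toList (hmax v hv)
      simp_rw [smul_comm _ (p v), ← Finset.smul_sum, this, smul_comm (p v)]
      exact congrArg (fun z => (-1 : ℤ) ^ d • p v • z)
        (Finset.sum_congr rfl fun σ _ => if_congr Iff.rfl rfl rfl)
    rw [Finset.sum_congr rfl h2, ← Finset.smul_sum, Finset.sum_comm] at h1
    have h3 := congrArg ((-1 : ℤ) ^ d • ·) h1
    simp only [smul_smul, ← mul_pow, neg_mul_neg, one_mul, one_pow, one_smul, smul_zero] at h3
    have h4 : ∀ σ : Equiv.Perm (Fin d), (∑ v ∈ p.support, p v •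
        if FreeMonoid.ofList (List.ofFn (w ∘ σ)) = v then (List.ofFn (y ∘ σ)).prod else 0) =
        p (FreeMonoid.ofList (List.ofFn (w ∘ σ))) • (List.ofFn (y ∘ σ)).prod := by
      intro σ
      simp only [smul_ite, smul_zero, Finset.sum_ite_eq]
      split_ifs with h
      · rfl
      · rw [Finsupp.notMem_support_iff.1 h, zero_smul]
    rw [Finset.sum_congr rfl fun σ _ => h4 σ] at h3
    simp only [← Algebra.smul_def, mul_smul]
    rw [← Finset.smul_sum, h3, smul_zero]

section

open Module
open scoped TensorProduct

/-! ### Multilinear identities and density -/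

section
variable {L M : Type*} [Field L] [AddCommGroup M] [Module L M]

/-- If `r i` maps `v (i + 1)` to `v i` and kills every other `v j`, then a product of `r i`'s can be
nonzero at `v k` only if its indices are consecutive and end at `k - 1`. -/
theorem prod_map_shift_ne_zero {d : ℕ} {r : Fin d → End L M} {v : Fin (d + 1) → M}
    (hr : ∀ i j, r i (v j) = if j = i.succ then v i.castSucc else 0) (k : Fin (d + 1))
    (l : List (Fin d)) (hl : (l.map r).prod (v k) ≠ 0) :
    ∃ j : Fin (d + 1), (l.map r).prod (v k) = v j ∧ (j : ℕ) + l.length = k ∧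
      l.map Fin.val = List.range' j l.length := by
  induction l with
  | nil => exact ⟨k, by simp⟩
  | cons i l ih =>
    rw [List.map_cons, List.prod_cons, End.mul_apply] at hl
    obtain ⟨j, hj, hjk, hjl⟩ := ih fun h => hl (by rw [h, map_zero])
    rw [hj, hr] at hl
    have hji : j = i.succ := by
      by_contra h
      exact hl (if_neg h)
    subst hji
    refine ⟨i.castSucc, ?_, ?_, ?_⟩
    · rw [List.map_cons, List.prod_cons, End.mul_apply, hj, hr, if_pos rfl]
    · simp at hjk ⊢; omega
    · simp [hjl, List.range'_succ]

theorem prod_map_shift {d : ℕ} {r : Fin d → End L M} {v : Fin (d + 1) → M}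
    (hr : ∀ i j, r i (v j) = if j = i.succ then v i.castSucc else 0) (k : Fin (d + 1))
    (l : List (Fin d)) (j : Fin (d + 1)) (hj : (j : ℕ) + l.length = k)
    (hl : l.map Fin.val = List.range' j l.length) :
    (l.map r).prod (v k) = v j := by
  induction l generalizing j with
  | nil => simp at hj ⊢; rw [Fin.ext hj]
  | cons i l ih =>
    simp [List.range'_succ] at hl hj
    have := ih i.succ (by simp; omega) (by simp [hl])
    rw [List.map_cons, List.prod_cons, End.mul_apply, this, hr, if_pos rfl]
    congr 1
    exact Fin.ext hl.1

/-- The shift operators `r i` detect the identity permutation: every product of all of them in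
another order kills the last vector. -/
theorem sum_prod_ofFn_shift {d : ℕ} {r : Fin d → End L M} {v : Fin (d + 1) → M}
    (hr : ∀ i j, r i (v j) = if j = i.succ then v i.castSucc else 0)
    (β : Equiv.Perm (Fin d) → End L M) :
    (∑ σ, β σ * (List.ofFn (r ∘ σ)).prod) (v (Fin.last d)) = β 1 (v 0) := by
  rw [LinearMap.sum_apply, Finset.sum_eq_single 1]
  · rw [End.mul_apply, ← List.map_ofFn, prod_map_shift hr _ _ 0]
    · simp
    · simp [List.map_ofFn, List.range'_eq_map_range]
      apply List.ext_getElem <;> simp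
  · intro σ _ hσ
    rw [End.mul_apply]
    by_cases h : (List.ofFn (r ∘ σ)).prod (v (Fin.last d)) = 0
    · rw [h, map_zero]
    refine (hσ ?_).elim
    rw [← List.map_ofFn] at h
    obtain ⟨j, -, hjk, hjl⟩ := prod_map_shift_ne_zero hr _ _ h
    have hj : (j : ℕ) = 0 := by simpa using hjk
    ext i
    have := congrArg (fun l => l[(i : ℕ)]?) hjl
    simpa [hj, List.getElem?_range'] using this
  · simp

end

theorem MultilinearMap.eq_zero_of_mem_span {R M N κ : Type*} [CommRing R]
    [AddCommGroup M] [Module R M] [AddCommGroup N] [Module R N] [Fintype κ]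
    (T : MultilinearMap R (fun _ : κ => M) N) {s : Set M}
    (h : ∀ x : κ → M, (∀ i, x i ∈ s) → T x = 0) (x : κ → M)
    (hx : ∀ i, x i ∈ Submodule.span R s) : T x = 0 := by
  classical
  choose n c g hg using fun i => Submodule.mem_span_set'.1 (hx i)
  obtain rfl : x = fun i => ∑ j, c i j • (g i j : M) := funext fun i => (hg i).symm
  rw [T.map_sum]
  refine Finset.sum_eq_zero fun f _ => ?_
  rw [T.map_smul_univ (fun i => c i (f i)) (fun i => (g i (f i) : M)),
    h _ fun i => (g i (f i)).2, smul_zero]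

section
variable {A L M : Type*} [Ring A] [Field L] [AddCommGroup M] [Module A M] [Module L M]
  [SMulCommClass A L M] [IsSimpleModule A M]

/-- Let `M` be a simple `A`-module on which a field `L` acts `A`-linearly, and let every
`A`-endomorphism of `M` that commutes with `L` be given by an element of `L`. Then the
`L`-subalgebra of `End L M` generated by `A` acts densely on the `L`-vector space `M`. -/
theorem exists_mem_adjoin_apply_eq
    (hL : ∀ f : End A M, (∀ (l : L) (m : M), f (l • m) = l • f m) → ∃ l : L, ∀ m, f m = l • m)
    {ι : Type*} [Finite ι] {v : ι → M} (hv : LinearIndependent L v) (w : ι → M) :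
    ∃ r ∈ Algebra.adjoin L (Set.range (toModuleEnd L (S := A) M)), ∀ i, r (v i) = w i := by
  classical
  cases nonempty_fintype ι
  set R := Algebra.adjoin L (Set.range (toModuleEnd L (S := A) M)) with hR
  have hA : ∀ a : A, toModuleEnd L M a ∈ R := fun a => Algebra.subset_adjoin ⟨a, rfl⟩
  have : IsSimpleModule R M := by
    have hs := isSimpleModule_iff_toSpanSingleton_surjective.1 (inferInstance : IsSimpleModule A M)
    refine isSimpleModule_iff_toSpanSingleton_surjective.2 ⟨hs.1, fun x hx y => ?_⟩
    obtain ⟨a, ha⟩ := hs.2 x hx y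
    exact ⟨⟨toModuleEnd L M a, hA a⟩, ha⟩
  obtain ⟨g, hg⟩ : ∃ g : End L M, ∀ i, g (v i) = w i := by
    obtain ⟨g, hg⟩ := LinearMap.exists_extend
      ((Finsupp.linearCombination L w).comp hv.repr)
    refine ⟨g, fun i => ?_⟩
    have := congr($hg ⟨v i, Submodule.subset_span ⟨i, rfl⟩⟩)
    simpa [hv.repr_eq_single i] using this
  have hend : ∀ φ : End R M, ∃ l : L, ∀ m, φ m = l • m := by
    intro φ
    refine hL ⟨φ.toAddHom, fun a m => φ.map_smul ⟨toModuleEnd L M a, hA a⟩ m⟩ fun l m => ?_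
    exact φ.map_smul (algebraMap L R l) m
  -- Endomorphisms over `R` are scalars from `L`, so the `L`-linear map `g` is linear over `End R M`.
  let G : End (End R M) M :=
    { g.toAddHom with
      map_smul' := fun φ m => by
        obtain ⟨l, hl⟩ := hend φ
        change g (φ m) = φ (g m)
        rw [hl, hl, map_smul] }
  obtain ⟨r, hr⟩ := jacobson_density G (Finset.univ.image v)
  refine ⟨r, r.2, fun i => ?_⟩
  rw [← hg i]
  exact (hr (v i) (Finset.mem_image_of_mem _ (Finset.mem_univ i))).symm

/-- If `A` satisfies a normalized multilinear identity of degree `d`, then so does the `L`-subalgebra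
of `End L M` generated by `A`. As it acts densely, `d + 1` linearly independent vectors of `M` would
provide shift operators violating this identity. -/
theorem finiteDimensional_of_multilinear_identity
    (hL : ∀ f : End A M, (∀ (l : L) (m : M), f (l • m) = l • f m) → ∃ l : L, ∀ m, f m = l • m)
    {d : ℕ} (β : Equiv.Perm (Fin d) → A) (hβ : β 1 = 1)
    (h : ∀ y : Fin d → A, ∑ σ, β σ * (List.ofFn (y ∘ σ)).prod = 0) :
    FiniteDimensional L M := by
  classical
  set ρ : A →+* End L M := toModuleEnd L M
  let T : MultilinearMap L (fun _ : Fin d => End L M) (End L M) :=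
    ∑ σ : Equiv.Perm (Fin d), (LinearMap.mulLeft L (ρ (β σ))).compMultilinearMap
      ((MultilinearMap.mkPiAlgebraFin L d (End L M)).domDomCongr σ)
  have hT : ∀ x, T x = ∑ σ, ρ (β σ) * (List.ofFn (x ∘ σ)).prod := by
    intro x
    simp [T, Function.comp_def]
  -- The range of `ρ` is closed under products, so the algebra it generates is its `L`-span.
  have hspan : ∀ r ∈ Algebra.adjoin L (Set.range ρ), r ∈ Submodule.span L (Set.range ρ) := by
    intro r hr
    have hcl : Submonoid.closure (Set.range ρ) = MonoidHom.mrange (ρ : A →* End L M) :=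
      Submonoid.closure_eq (MonoidHom.mrange (ρ : A →* End L M))
    rw [← Subalgebra.mem_toSubmodule, Algebra.adjoin_eq_span, hcl] at hr
    exact hr
  have hT0 : ∀ x : Fin d → End L M, (∀ i, x i ∈ Algebra.adjoin L (Set.range ρ)) → T x = 0 := by
    intro x hx
    refine T.eq_zero_of_mem_span (s := Set.range ρ) (fun x hx => ?_) x fun i => hspan _ (hx i)
    choose y hy using hx
    obtain rfl : (fun i => ρ (y i)) = x := funext hy
    have := congrArg ρ (h y)
    rw [map_sum, map_zero] at this
    rw [hT, ← this]
    refine Finset.sum_congr rfl fun σ _ => ?_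
    rw [map_mul, map_list_prod, List.map_ofFn]
    rfl
  refine Module.rank_lt_aleph0_iff.1 ((rank_le (n := d) fun s hs => ?_).trans_lt
    Cardinal.natCast_lt_aleph0)
  by_contra! hlt
  obtain ⟨e⟩ : Nonempty (Fin (d + 1) ↪ s) := by
    rw [Function.Embedding.nonempty_iff_card_le]
    simpa using hlt
  set v : Fin (d + 1) → M := fun i => (e i : M)
  have hv : LinearIndependent L v := hs.comp e e.injective
  choose r hrm hr using fun i : Fin d => exists_mem_adjoin_apply_eq (A := A) hL hv
    (fun j => if j = i.succ then v i.castSucc else 0)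
  have := sum_prod_ofFn_shift (r := r) (v := v) hr (fun σ => ρ (β σ))
  rw [← hT, hT0 r hrm, hβ, map_one] at this
  exact hv.ne_zero 0 this.symm

end

/-! ### Extension of scalars of a central simple algebra -/

/-- For a simple ring `A`, every nonzero sub-bimodule of `ι →₀ A` contains a nonzero element with
central coordinates. -/
theorem exists_central_of_bimodule {A ι : Type*} [Ring A] [IsSimpleRing A]
    (N : AddSubgroup (ι →₀ A))
    (hl : ∀ (a : A), ∀ x ∈ N, x.mapRange (a * ·) (mul_zero a) ∈ N)
    (hr : ∀ (a : A), ∀ x ∈ N, x.mapRange (· * a) (zero_mul a) ∈ N) (hN : N ≠ ⊥) :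
    ∃ x ∈ N, x ≠ 0 ∧ ∀ i, x i ∈ Subring.center A := by
  classical
  by_contra! hcon
  refine hN ((AddSubgroup.eq_bot_iff_forall N).2 ?_)
  -- By induction on `s`, an element of `N` supported in `s` is zero. If `x` is supported in
  -- `insert i s`, the `i`-th coordinates of such elements form an ideal, so some `y` has `y i = 1`.
  -- The commutators of `y` with elements of `A` are supported in `s`, hence zero.
  suffices H : ∀ s : Finset ι, ∀ x ∈ N, x.support ⊆ s → x = 0 from fun x hx => H _ x hx subset_rfl
  intro s
  induction s using Finset.induction with
  | empty => exact fun x _ hx => by simpa using hx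
  | insert i s hi ih =>
    intro x hx hxs
    have hdrop : ∀ y ∈ N, y.support ⊆ insert i s → y i = 0 → y = 0 := fun y hy hys hyi =>
      ih y hy fun j hj => (Finset.mem_insert.1 (hys hj)).resolve_left <| by
        rintro rfl
        exact Finsupp.mem_support_iff.1 hj hyi
    have hsupp : ∀ {y : ι →₀ A}, y.support ⊆ insert i s ↔ ∀ j ∉ insert i s, y j = 0 :=
      fun {y} => Finsupp.support_subset_iff.trans (by simp)
    by_contra hx0
    let J : TwoSidedIdeal A := .mk' {a | ∃ y ∈ N, y.support ⊆ insert i s ∧ y i = a}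
      ⟨0, N.zero_mem, by simp, rfl⟩
      (by
        rintro _ _ ⟨y, hy, hys, rfl⟩ ⟨z, hz, hzs, rfl⟩
        refine ⟨y + z, N.add_mem hy hz, hsupp.2 fun j hj => ?_, rfl⟩
        simp [hsupp.1 hys j hj, hsupp.1 hzs j hj])
      (by
        rintro _ ⟨y, hy, hys, rfl⟩
        exact ⟨-y, N.neg_mem hy, by simpa using hys, rfl⟩)
      (by
        rintro a _ ⟨y, hy, hys, rfl⟩
        refine ⟨_, hl a y hy, hsupp.2 fun j hj => ?_, by simp⟩
        simp [hsupp.1 hys j hj])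
      (by
        rintro _ a ⟨y, hy, hys, rfl⟩
        refine ⟨_, hr a y hy, hsupp.2 fun j hj => ?_, by simp⟩
        simp [hsupp.1 hys j hj])
    have h1 : (1 : A) ∈ J := IsSimpleRing.one_mem_of_ne_zero_mem J
      (x := x i) (fun h => hx0 (hdrop x hx hxs h)) (by
        simp only [J, TwoSidedIdeal.mem_mk']
        exact ⟨x, hx, hxs, rfl⟩)
    simp only [J, TwoSidedIdeal.mem_mk'] at h1
    obtain ⟨y, hy, hys, hyi⟩ := h1
    obtain ⟨j, hj⟩ := hcon y hy fun h => one_ne_zero (hyi.symm.trans (by simp [h]))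
    refine hj (Subring.mem_center_iff.2 fun a => ?_)
    have := hdrop _ (N.sub_mem (hl a y hy) (hr a y hy))
      (hsupp.2 fun j hj => by simp [hsupp.1 hys j hj]) (by simp [hyi])
    simpa [sub_eq_zero] using congr($this j)

/-- For `A` central simple over `Z`, the map `L ⊗ A → End L M` given by the actions is injective. Its
kernel, in coordinates with respect to a `Z`-basis of `L`, is a sub-bimodule of `ι →₀ A`; if it is
nonzero it has an element with coordinates in `Z`, that is, one coming from `L`, but `L` acts
faithfully. -/
theorem injective_tensor_end {Z A L M : Type*} [Field Z] [Ring A] [Algebra Z A]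
    [Algebra.IsCentral Z A] [IsSimpleRing A] [Field L] [Algebra Z L] [AddCommGroup M]
    [Nontrivial M] [Module A M] [Module L M] [Module Z M] [IsScalarTower Z A M]
    [IsScalarTower Z L M] [SMulCommClass A L M] (μ : L ⊗[Z] A →ₗ[L] End L M)
    (hμ : ∀ l a m, μ (l ⊗ₜ a) m = l • a • m) :
    Function.Injective μ := by
  classical
  have : SMulCommClass Z L M := IsScalarTower.to_smulCommClass
  let b := Basis.ofVectorSpace Z L
  let e := TensorProduct.equivFinsuppOfBasisLeft (N := A) b
  have he : ∀ (x : _ →₀ A) (m : M), μ (e.symm x) m = x.sum fun i a => b i • a • m := by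
    intro x m
    rw [TensorProduct.equivFinsuppOfBasisLeft_symm_apply]
    simp [Finsupp.sum, hμ]
  let N : AddSubgroup (Basis.ofVectorSpaceIndex Z L →₀ A) :=
    (LinearMap.ker (μ.restrictScalars Z ∘ₗ e.symm.toLinearMap)).toAddSubgroup
  have hN : ∀ x, x ∈ N ↔ ∀ m : M, (x.sum fun i a => b i • a • m) = 0 := by
    intro x
    simp only [← he]
    exact LinearMap.mem_ker.trans LinearMap.ext_iff
  suffices h : N = ⊥ by
    refine (injective_iff_map_eq_zero μ).2 fun t ht => ?_
    have : e t ∈ N := by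
      change μ (e.symm (e t)) = 0
      rw [e.symm_apply_apply, ht]
    rw [h] at this
    simpa using this
  by_contra hne
  obtain ⟨x, hx, hx0, hxc⟩ := exists_central_of_bimodule N
    (fun a x hx => by
      rw [hN] at hx ⊢
      intro m
      have := congrArg (a • ·) (hx m)
      rw [Finsupp.sum_mapRange_index (by simp)]
      simpa [Finsupp.sum, Finset.smul_sum, mul_smul, smul_comm a] using this)
    (fun a x hx => by
      rw [hN] at hx ⊢
      intro m
      rw [Finsupp.sum_mapRange_index (by simp)]
      simpa [mul_smul] using hx (a • m)) hne
  have hz : ∀ i, ∃ z : Z, x i = algebraMap Z A z := fun i =>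
    (Algebra.IsCentral.mem_center_iff Z).1 (Subalgebra.mem_center_iff.2
      (Subring.mem_center_iff.1 (hxc i)))
  choose z hz using hz
  obtain ⟨m, hm⟩ := exists_ne (0 : M)
  have h0 : ∑ i ∈ x.support, z i • b i = 0 := by
    refine (smul_eq_zero.1 ?_).resolve_right hm
    rw [Finset.sum_smul, ← (hN x).1 hx m]
    refine Finset.sum_congr rfl fun i _ => ?_
    change (z i • b i) • m = b i • x i • m
    rw [hz i, algebraMap_smul, smul_assoc, smul_comm]
  refine hx0 (Finsupp.ext fun i => ?_)
  by_cases hi : i ∈ x.support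
  · rw [hz, linearIndependent_iff'.1 b.linearIndependent _ _ h0 i hi, map_zero, Finsupp.zero_apply]
  · exact Finsupp.notMem_support_iff.1 hi

/-- The dimension of `A` over `Z` is that of `L ⊗ A` over `L`, and `L ⊗ A` embeds in `End L M`. -/
theorem finiteDimensional_of_isCentral_of_module {Z A L M : Type*} [Field Z] [Ring A] [Algebra Z A]
    [Algebra.IsCentral Z A] [IsSimpleRing A] [Field L] [Algebra Z L] [AddCommGroup M]
    [Nontrivial M] [Module A M] [Module L M] [Module Z M] [IsScalarTower Z A M]
    [IsScalarTower Z L M] [SMulCommClass A L M] [FiniteDimensional L M] :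
    FiniteDimensional Z A := by
  have : SMulCommClass A Z M := IsScalarTower.to_smulCommClass'
  let ρ : A →ₗ[Z] End L M :=
    { toFun := toModuleEnd L M
      map_add' := map_add _
      map_smul' := fun z a => by
        ext m
        exact smul_assoc z a m }
  have hinj := injective_tensor_end (ρ.liftBaseChange L) fun l a m => by
    simp [ρ]
  have := Module.Finite.of_injective _ hinj
  have h1 := Module.rank_lt_aleph0 L (L ⊗[Z] A)
  rw [Module.rank_baseChange, Cardinal.lift_lt_aleph0] at h1
  exact Module.rank_lt_aleph0_iff.1 h1

/-! ### Kaplansky's theorem -/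

/-- A maximal set of pairwise commuting elements is its own centralizer. -/
theorem exists_maximal_commuting (D : Type*) [Monoid D] :
    ∃ s : Set D, s.centralizer = s := by
  obtain ⟨s, hs⟩ := zorn_subset {s : Set D | s ⊆ s.centralizer} (fun c hc hchain =>
    ⟨⋃₀ c, fun x hx y hy => by
      obtain ⟨t, ht, hxt⟩ := hx
      obtain ⟨u, hu, hyu⟩ := hy
      rcases hchain.total ht hu with h | h
      · exact hc hu (h hxt) y hyu
      · exact hc ht hxt y (h hyu), fun t ht => Set.subset_sUnion_of_mem ht⟩)
  refine ⟨s, Set.Subset.antisymm (fun x hx => ?_) hs.prop⟩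
  refine hs.le_of_ge (y := insert x s) ?_ (Set.subset_insert x s) (Set.mem_insert x s)
  rintro y (rfl | hy) z (rfl | hz)
  · rfl
  · exact hx z hz
  · exact (hx y hy).symm
  · exact hs.prop hy z hz

/-- **Kaplansky's theorem** for a central simple algebra `A`, with the polynomial identity in
normalized multilinear form. -/
theorem finiteDimensional_of_isCentral_of_multilinear_identity {Z A : Type*} [Field Z] [Ring A]
    [Algebra Z A] [Algebra.IsCentral Z A] [IsSimpleRing A]
    {d : ℕ} (β : Equiv.Perm (Fin d) → A) (hβ : β 1 = 1)
    (h : ∀ y : Fin d → A, ∑ σ, β σ * (List.ofFn (y ∘ σ)).prod = 0) :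
    FiniteDimensional Z A := by
  classical
  obtain ⟨I, hI⟩ := Ideal.exists_maximal A
  have : IsSimpleModule A (A ⧸ I) := isSimpleModule_iff_isCoatom.2 hI.out
  have : SMulCommClass A Z (A ⧸ I) := IsScalarTower.to_smulCommClass'
  -- `D` is a division ring by Schur's lemma, and `L` is a maximal subfield of it.
  let D := End A (A ⧸ I)
  obtain ⟨s, hs⟩ := exists_maximal_commuting D
  let L : Subalgebra Z D := Subalgebra.centralizer Z s
  have hLs : ∀ x : D, x ∈ L ↔ x ∈ s := fun x => by
    conv_rhs => rw [← hs]
    rfl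
  have hcomm : ∀ x y : L, x * y = y * x := fun x y =>
    Subtype.ext (y.2 x ((hLs x).1 x.2))
  let cL : CommRing L := { (inferInstance : Ring L) with mul_comm := hcomm }
  have hfield : IsField L :=
    { exists_pair_ne := exists_pair_ne L
      mul_comm := hcomm
      mul_inv_cancel := fun {x} hx => by
        have hx0 : (x : D) ≠ 0 := fun h => hx (Subtype.ext h)
        refine ⟨⟨(x : D)⁻¹, fun y hy => ?_⟩, Subtype.ext (mul_inv_cancel₀ hx0)⟩
        have hc : Commute y (x : D) := x.2 y hy
        exact hc.inv_right₀ }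
  let _ : Field L := hfield.toField
  have : SMulCommClass A L (A ⧸ I) := ⟨fun a l m => ((l : D).map_smul a m).symm⟩
  have : IsScalarTower Z L (A ⧸ I) := ⟨fun z l m => rfl⟩
  have : Nontrivial (A ⧸ I) := IsSimpleModule.nontrivial A _
  have : FiniteDimensional L (A ⧸ I) := finiteDimensional_of_multilinear_identity (A := A)
    (fun f hf => ⟨⟨f, fun y hy => LinearMap.ext fun m => (hf ⟨y, (hLs y).2 hy⟩ m).symm⟩,
      fun m => rfl⟩) β hβ h
  exact finiteDimensional_of_isCentral_of_module (L := L) (M := A ⧸ I)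

theorem IsSimplePIAlgebra.exists_isFDCentralSimple {K : Type u} {A : Type v} [Field K]
    [Ring A] [Algebra K A] (h : IsSimplePIAlgebra K A) :
    ∃ (F : Type v) (_ : Field F) (_ : Algebra F A), IsFDCentralSimple F A := by
  obtain ⟨hs, hpi⟩ := h
  let _ := (IsSimpleRing.isField_center A).toField
  have hc : Algebra.IsCentral (Subring.center A) A :=
    ⟨fun x hx => ⟨⟨x, Subring.mem_center_iff.2 (Subalgebra.mem_center_iff.1 hx)⟩, rfl⟩⟩
  obtain ⟨d, β, hβ, hid⟩ := hpi.exists_multilinear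
  exact ⟨Subring.center A, inferInstance, inferInstance, hs, hc,
    finiteDimensional_of_isCentral_of_multilinear_identity β hβ hid⟩

/-! ### The standard identity -/

/-- The standard polynomial is alternating and `F`-multilinear, so it vanishes at linearly dependent
arguments. -/
theorem sum_sign_smul_prod_eq_zero {F A : Type*} [Field F] [Ring A] [Algebra F A]
    [FiniteDimensional F A] {n : ℕ} (hn : finrank F A < n) (x : Fin n → A) :
    ∑ σ : Equiv.Perm (Fin n), (Equiv.Perm.sign σ : ℤ) • (List.ofFn (x ∘ σ)).prod = 0 := by
  have h : ¬ LinearIndependent F x := fun h => by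
    have := h.fintype_card_le_finrank
    simp at this
    omega
  have := (MultilinearMap.alternatization
    (MultilinearMap.mkPiAlgebraFin F n A)).map_linearDependent x h
  rw [MultilinearMap.alternatization_apply] at this
  simpa [Function.comp_def, Units.smul_def] using this

/-- The standard polynomial `∑ σ, sign σ • X_{σ 0} ⋯ X_{σ (n - 1)}`, as an element of the free algebra
with indeterminates indexed by `ℕ`. -/
noncomputable def standardPolynomial (K : Type*) [Field K] (n : ℕ) : FreeAlgebra K ℕ :=
  ∑ σ : Equiv.Perm (Fin n), (Equiv.Perm.sign σ : ℤ) •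
    (List.ofFn fun i => FreeAlgebra.ι K (σ i : ℕ)).prod

theorem lift_standardPolynomial {K A : Type*} [Field K] [Ring A] [Algebra K A] (n : ℕ)
    (x : ℕ → A) : FreeAlgebra.lift K x (standardPolynomial K n) =
      ∑ σ : Equiv.Perm (Fin n),
        (Equiv.Perm.sign σ : ℤ) • (List.ofFn ((fun i : Fin n => x i) ∘ σ)).prod := by
  simp [standardPolynomial, map_list_prod, List.map_ofFn, Function.comp_def]

theorem FreeMonoid.prod_map_of {X : Type*} (l : List X) :
    (l.map FreeMonoid.of).prod = FreeMonoid.ofList l := by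
  induction l with
  | nil => rfl
  | cons a l ih => rw [List.map_cons, List.prod_cons, ih, FreeMonoid.ofList_cons]

/-- The coefficient of `X₀ ⋯ X_{n - 1}` is `1`, as is seen by evaluating at the generators of the
algebra of the free monoid. -/
theorem standardPolynomial_ne_zero (K : Type*) [Field K] (n : ℕ) : standardPolynomial K n ≠ 0 := by
  classical
  intro h
  have h1 := lift_standardPolynomial (K := K) n fun j => MonoidAlgebra.of K _ (FreeMonoid.of j)
  have hprod : ∀ σ : Equiv.Perm (Fin n),
      (List.ofFn ((fun i : Fin n => MonoidAlgebra.of K _ (FreeMonoid.of (i : ℕ))) ∘ σ)).prod =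
        MonoidAlgebra.single (FreeMonoid.ofList (List.ofFn fun i => (σ i : ℕ))) (1 : K) := by
    intro σ
    rw [← FreeMonoid.prod_map_of, ← MonoidAlgebra.of_apply, map_list_prod, List.map_ofFn,
      List.map_ofFn]
    rfl
  simp only [h, map_zero, hprod] at h1
  have h2 := congrArg (fun f => f.coeff (FreeMonoid.ofList (List.ofFn fun i : Fin n => (i : ℕ)))) h1
  have hinj : ∀ σ : Equiv.Perm (Fin n), FreeMonoid.ofList (List.ofFn fun i => (σ i : ℕ)) =
      FreeMonoid.ofList (List.ofFn fun i : Fin n => (i : ℕ)) ↔ σ = 1 := fun σ => by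
    rw [FreeMonoid.ofList.apply_eq_iff_eq, List.ofFn_inj, funext_iff, Equiv.ext_iff]
    simp [Fin.ext_iff]
  simp [Finsupp.single_apply, hinj] at h2

/-- The base field `K` of the identity may be any field over which `A` is an algebra, because the
standard polynomial has integer coefficients. -/
theorem IsFDCentralSimple.isSimplePIAlgebra {F A : Type*} [Field F] [Ring A] [Algebra F A]
    (h : IsFDCentralSimple F A) (K : Type*) [Field K] [Algebra K A] : IsSimplePIAlgebra K A := by
  obtain ⟨hs, -, hfd⟩ := h
  refine ⟨hs, standardPolynomial K (finrank F A + 1), standardPolynomial_ne_zero K _, fun x => ?_⟩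
  rw [lift_standardPolynomial]
  exact sum_sign_smul_prod_eq_zero (F := F) (Nat.lt_succ_self _) _

end

/-! ### Comparison of the two classes of algebras -/

theorem mainTheorem6 (K : Type u) (A : Type v) [Field K] [Ring A] [Algebra K A] :
    (IsAlmostLocallySimplePI K A ↔ IsAlmostLocallyFDCentralSimple K A) ∧
    (IsSimplePIAlgebra K A ↔
      ∃ (F : Type v) (_ : Field F) (_ : Algebra F A), IsFDCentralSimple F A) := by
  refine ⟨forall_congr' fun B => imp_congr_right fun _ => exists_congr fun C =>
    and_congr_right fun _ => ⟨?_, ?_⟩, IsSimplePIAlgebra.exists_isFDCentralSimple, ?_⟩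
  · rintro ⟨F, _, _, h⟩
    exact h.exists_isFDCentralSimple
  · rintro ⟨F, _, _, h⟩
    exact ⟨F, _, _, h.isSimplePIAlgebra F⟩
  · rintro ⟨F, _, _, h⟩
    exact h.isSimplePIAlgebra K
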